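/- Let $H_n = 1 + \tfrac12 + \cdots + \tfrac1n$ and let $m \ge 1$ be an integer. The Dirichlet series $$\mathcal{H}^m(s) = \sum_{n=1}^{\infty} \frac{H_n^m}{n^s}$$ converges absolutely for $\Re(s) > 1$ and extends to a meromorphic function $\mathcal{H}^m(z)$ on $\mathbb{C}$. This extension is holomorphic on $\mathbb{C} \setminus \{1, 0, -1, -2, \dots\}$, and at the points $z = 1, 0, -1, -2, -3, -4, -5, -6, \dots$ it has poles of the respective orders $$m+1,\ m,\ m,\ m-1,\ m,\ m-1,\ m,\ m-1,\ \dots,$$ that is, order $m+1$ at $z = 1$, order $m$ at $z = 0$ and at every negative odd integer, and order $m-1$ at every negative even integer. Here "a pole of order $k$ at $z_0$" means that $(z - z_0)^k\,\mathcal{H}^m(z)$ extends holomorphically to a neighbourhood of $z_0$ with a nonzero value at $z_0$; so for $m = 1$ the order $0$ at the negative even integers means that $\mathcal{H}^1$ is holomorphic and nonzero there. -/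

import Mathlib

/-- The coefficients `H_n ^ m` (with `H_n = 1 + 1/2 + ⋯ + 1/n`) of the Dirichlet series. -/
noncomputable def harmonicPow (m n : ℕ) : ℂ := ((harmonic n : ℚ) : ℂ) ^ m

/-- The Dirichlet series `∑_{n ≥ 1} H_n ^ m / n ^ s`. (The `n = 0` term of Mathlib's
`LSeries` is `0` by definition.) -/
noncomputable def harmonicZeta (m : ℕ) (s : ℂ) : ℂ := LSeries (harmonicPow m) s

/-- `F` has a pole of order `k` at `z₀`: near `z₀` it is `(z - z₀) ^ (-k)` times an analytic
function that does not vanish at `z₀`. For `k = 0` this means that, up to its value at `z₀`,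
`F` is analytic and nonzero there. -/
def HasPoleOfOrder (F : ℂ → ℂ) (z₀ : ℂ) (k : ℤ) : Prop :=
  MeromorphicAt F z₀ ∧ meromorphicOrderAt F z₀ = ((-k : ℤ) : WithTop ℤ)

/-!
Write `w = 1 - s`, and let `B_j` be the Bernoulli numbers. The truncated Bernoulli "polynomial" of
complex degree `E(n) = ∑_{j < K} (w choose j) B_j n ^ (w - j)` satisfies
`E(n + 1) - E(n) = w n ^ (w - 1) + O(n ^ (re w - K))`, locally uniformly in `w`
(`exists_norm_bernoulliError_le`), and the error vanishes when `w < K` is a positive integer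
(`bernoulliError_natCast`). Summation by parts, together with
`H_{n - 1} ^ m = (H_n - 1 / n) ^ m`, gives (`one_sub_mul_harmonicZeta`)

`(1 - s) 𝓗 ^ m (s) = ∑_{1 ≤ i ≤ m} ∑_{j < K} (-1) ^ i (m choose i) (1 - s choose j) B_j
  𝓗 ^ (m - i) (s + i + j - 1) - R_K(s)`

with `R_K` holomorphic on `m + 2 - K < re s` and zero at the points `s = 1 - p`, `0 < p < K`. So
the series for the exponent `m` is continued through those for smaller exponents, starting from
`𝓗 ^ 0 = ζ`; the continuations to the various half-planes agree by the identity theorem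
(`exists_meromorphicNFAt_glue`).

The same formula gives the leading coefficients by induction on `m`, for `m ≥ 1`. The coefficient
of `(s - (1 - N)) ^ (-m)` in `(1 - s) 𝓗 ^ m (s)` comes only from the pole of `𝓗 ^ (m - 1)` at `1`
in the term `i = 1`, `j = N`, and equals `-m! B_N` (`harmonicExpansion_coeff`). It is nonzero for
`N = 0`, `N = 1` and even `N`; at `N = 0` the factor `1 - s` raises the order of the pole by one.
For odd `N = p + 1 ≥ 3`, where `B_N = 0`, the order is `m - 1`, and three terms contribute:
`(i, j) = (1, 1), (1, p), (2, p)` (`exists_harmonicExpansion_coeff_of_odd`). For `m ≥ 2` the last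
two cancel, and what remains is a nonzero multiple of `B_p`. For `m = 1` the third is absent, and
`ζ 0 = -1/2` makes the value at `1 - N` equal to `(1 - 1 / p) B_p / 2`, which is nonzero as well.
-/

open Filter Topology

/-! ### Bernoulli polynomials of complex degree -/

theorem succ_mul_choose_succ_eq (w : ℂ) (j : ℕ) :
    ((j : ℂ) + 1) * Ring.choose w (j + 1) = Ring.choose w j * (w - j) := by
  have h := Ring.choose_smul_choose w (Nat.le_succ j)
  simpa [Nat.choose_succ_self_right] using h

theorem succ_mul_choose_succ_eq' (w : ℂ) (j : ℕ) :
    ((j : ℂ) + 1) * Ring.choose w (j + 1) = w * Ring.choose (w - 1) j := by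
  have h := Ring.choose_smul_choose w (Nat.succ_le_succ (Nat.zero_le j))
  simpa using h

theorem differentiable_choose (j : ℕ) : Differentiable ℂ fun w : ℂ => Ring.choose w j := by
  induction j with
  | zero => simp
  | succ j ih =>
    have h : (fun w : ℂ => Ring.choose w (j + 1)) =
        fun w => Ring.choose w j * (w - j) / ((j : ℂ) + 1) := by
      funext w
      rw [← succ_mul_choose_succ_eq, mul_div_cancel_left₀]
      exact_mod_cast Nat.succ_ne_zero j
    rw [h]
    fun_prop

theorem one_add_ofReal_mem_slitPlane {x : ℝ} (hx : 0 ≤ x) : (1 + x : ℂ) ∈ Complex.slitPlane :=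
  .inl (by simp; linarith)

theorem hasDerivAt_one_add_cpow_sub_sum (w : ℂ) (M : ℕ) {x : ℝ} (hx : 0 ≤ x) :
    HasDerivAt (fun y : ℝ => (1 + y : ℂ) ^ w -
        ∑ i ∈ Finset.range (M + 1), Ring.choose w i * (y : ℂ) ^ i)
      (w * ((1 + x : ℂ) ^ (w - 1) -
        ∑ i ∈ Finset.range M, Ring.choose (w - 1) i * (x : ℂ) ^ i)) x := by
  have h1 : HasDerivAt (fun z : ℂ => (1 + z) ^ w) (w * (1 + x : ℂ) ^ (w - 1) * 1) (x : ℂ) :=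
    ((hasDerivAt_id _).const_add 1).cpow_const (one_add_ofReal_mem_slitPlane hx)
  have h2 : HasDerivAt (fun z : ℂ => ∑ i ∈ Finset.range (M + 1), Ring.choose w i * z ^ i)
      (∑ i ∈ Finset.range (M + 1), Ring.choose w i * (i * (x : ℂ) ^ (i - 1))) (x : ℂ) :=
    HasDerivAt.fun_sum fun i _ => (hasDerivAt_pow i _).const_mul _
  refine (h1.sub h2).comp_ofReal.congr_deriv ?_
  rw [Finset.sum_range_succ']
  simp only [Nat.cast_add, Nat.cast_one, add_tsub_cancel_right, Nat.cast_zero, zero_mul, mul_zero,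
    add_zero, mul_one, mul_sub, Finset.mul_sum]
  congr 1
  refine Finset.sum_congr rfl fun i _ => ?_
  rw [← mul_assoc, ← mul_assoc, ← succ_mul_choose_succ_eq']
  ring

/-- The binomial expansion of `(1 + x) ^ w`, with a remainder that is uniform in `x ∈ [0, 1]` and
in `w` from a bounded set. Differentiating in `x` multiplies the remainder by `w` and lowers both
`w` and the number of terms by one. -/
theorem exists_norm_one_add_cpow_sub_sum_le (M : ℕ) (R : ℝ) :
    ∃ C : ℝ, 0 ≤ C ∧ ∀ w : ℂ, ‖w‖ ≤ R → ∀ x : ℝ, 0 ≤ x → x ≤ 1 →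
      ‖(1 + x : ℂ) ^ w - ∑ i ∈ Finset.range M, Ring.choose w i * (x : ℂ) ^ i‖ ≤ C * x ^ M := by
  induction M generalizing R with
  | zero =>
    refine ⟨2 ^ |R|, by positivity, fun w hw x h0 h1 => ?_⟩
    have h : (1 + x : ℂ) = ((1 + x : ℝ) : ℂ) := by push_cast; rfl
    rw [Finset.range_zero, Finset.sum_empty, sub_zero, pow_zero, mul_one, h,
      Complex.norm_cpow_eq_rpow_re_of_pos (by linarith)]
    have hre : w.re ≤ |R| := (Complex.re_le_norm w).trans (hw.trans (le_abs_self R))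
    calc (1 + x) ^ w.re ≤ (1 + x) ^ |R| := Real.rpow_le_rpow_of_exponent_le (by linarith) hre
      _ ≤ 2 ^ |R| := Real.rpow_le_rpow (by linarith) (by linarith) (abs_nonneg R)
  | succ M ih =>
    obtain ⟨C, hC, h⟩ := ih (R + 1)
    refine ⟨|R| * C, by positivity, fun w hw x h0 h1 => ?_⟩
    have hw1 : ‖w - 1‖ ≤ R + 1 := (norm_sub_le _ _).trans (by simpa using hw)
    have key := (convex_Icc (0 : ℝ) x).norm_image_sub_le_of_norm_hasDerivWithin_le
      (f := fun y : ℝ => (1 + y : ℂ) ^ w -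
        ∑ i ∈ Finset.range (M + 1), Ring.choose w i * (y : ℂ) ^ i) (C := |R| * (C * x ^ M))
      (fun y hy => (hasDerivAt_one_add_cpow_sub_sum w M hy.1).hasDerivWithinAt)
      (fun y hy => by
        rw [norm_mul]
        refine mul_le_mul (hw.trans (le_abs_self R)) ((h _ hw1 y hy.1 (hy.2.trans h1)).trans ?_)
          (norm_nonneg _) (abs_nonneg R)
        have := hy.1
        have := hy.2
        gcongr)
      (Set.left_mem_Icc.2 h0) (Set.right_mem_Icc.2 h0)
    have hz : (1 + ((0 : ℝ) : ℂ)) ^ w -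
        ∑ i ∈ Finset.range (M + 1), Ring.choose w i * ((0 : ℝ) : ℂ) ^ i = 0 := by
      simp [Finset.sum_range_succ']
    simp only [hz, sub_zero] at key
    refine key.trans_eq ?_
    rw [Real.norm_of_nonneg h0]
    ring

/-- The Bernoulli polynomial of complex degree `w`, truncated after `K` terms:
`∑_{j < K} (w choose j) B_j x ^ (w - j)`. -/
noncomputable def truncBernoulli (K : ℕ) (w x : ℂ) : ℂ :=
  ∑ j ∈ Finset.range K, Ring.choose w j * (bernoulli j : ℂ) * x ^ (w - j)

/-- The error in the difference equation `B_w(n + 1) - B_w(n) = w n ^ (w - 1)` when `B_w` is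
replaced by its truncation. -/
noncomputable def bernoulliError (K : ℕ) (w : ℂ) (n : ℕ) : ℂ :=
  truncBernoulli K w (n + 1) - truncBernoulli K w n - w * (n : ℂ) ^ (w - 1)

theorem sum_choose_mul_bernoulli (N : ℕ) :
    ∑ j ∈ Finset.range N, (N.choose j : ℂ) * (bernoulli j : ℂ) = if N = 1 then 1 else 0 := by
  have h := congrArg (Rat.cast : ℚ → ℂ) (sum_bernoulli N)
  push_cast at h
  rw [h]
  split_ifs <;> simp

/-- The coefficients of `x ^ N`, `N < K`, in the expansion of `B_w(n + 1) - B_w(n)` in `x = 1 / n`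
are those of `w x`. -/
theorem sum_choose_bernoulli_flip {K : ℕ} (hK : 2 ≤ K) (w x : ℂ) :
    ∑ j ∈ Finset.range K, Ring.choose w j * (bernoulli j : ℂ) * x ^ j *
      ∑ i ∈ Finset.range (K - j), Ring.choose (w - j) i * x ^ i =
    (∑ j ∈ Finset.range K, Ring.choose w j * (bernoulli j : ℂ) * x ^ j) + w * x := by
  simp only [Finset.mul_sum]
  rw [← Finset.sum_range_diag_flip K fun j i =>
    Ring.choose w j * (bernoulli j : ℂ) * x ^ j * (Ring.choose (w - j) i * x ^ i)]
  have h : ∀ N ∈ Finset.range K, (∑ j ∈ Finset.range (N + 1),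
      Ring.choose w j * (bernoulli j : ℂ) * x ^ j *
        (Ring.choose (w - j) (N - j) * x ^ (N - j))) =
      Ring.choose w N * (bernoulli N : ℂ) * x ^ N + if N = 1 then w * x else 0 := by
    intro N _
    have h1 : ∀ j ∈ Finset.range (N + 1), Ring.choose w j * (bernoulli j : ℂ) * x ^ j *
        (Ring.choose (w - j) (N - j) * x ^ (N - j)) =
        Ring.choose w N * x ^ N * ((N.choose j : ℂ) * (bernoulli j : ℂ)) := by
      intro j hj
      have hjN : j ≤ N := Nat.lt_succ_iff.1 (Finset.mem_range.1 hj)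
      have h2 := Ring.choose_smul_choose w hjN
      rw [nsmul_eq_mul] at h2
      rw [← pow_sub_mul_pow x hjN]
      linear_combination (-(bernoulli j : ℂ) * (x ^ (N - j) * x ^ j)) * h2
    rw [Finset.sum_congr rfl h1, ← Finset.mul_sum, Finset.sum_range_succ,
      sum_choose_mul_bernoulli]
    split_ifs with hN
    · subst hN
      simp
      ring
    · simp
      ring
  rw [Finset.sum_congr rfl h, Finset.sum_add_distrib, Finset.sum_ite_eq', if_pos]
  exact Finset.mem_range.2 hK

theorem bernoulliError_eq (K : ℕ) (w : ℂ) {n : ℕ} (hn : n ≠ 0) :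
    bernoulliError K w n = (n : ℂ) ^ w *
      (∑ j ∈ Finset.range K, Ring.choose w j * (bernoulli j : ℂ) * ((n : ℂ)⁻¹) ^ j *
        ((1 + ((n : ℝ)⁻¹ : ℝ) : ℂ) ^ (w - j) - 1) - w * (n : ℂ)⁻¹) := by
  have hn' : (n : ℂ) ≠ 0 := Nat.cast_ne_zero.2 hn
  have hn0 : (0 : ℝ) < n := by positivity
  have hsucc : ((n : ℂ) + 1) = ((n : ℝ) : ℂ) * ((1 + (n : ℝ)⁻¹ : ℝ) : ℂ) := by
    push_cast
    field_simp
  simp only [bernoulliError, truncBernoulli]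
  rw [← Finset.sum_sub_distrib, mul_sub, Finset.mul_sum]
  congr 1
  · refine Finset.sum_congr rfl fun j _ => ?_
    rw [hsucc, Complex.mul_cpow_ofReal_nonneg hn0.le (by positivity), Complex.ofReal_natCast,
      Complex.cpow_sub _ _ hn', Complex.cpow_natCast, inv_pow]
    push_cast
    generalize (1 + (n : ℂ)⁻¹) ^ (w - j) = t
    field_simp
  · rw [Complex.cpow_sub _ _ hn', Complex.cpow_one]
    field_simp

/-- Factoring out `n ^ w`, the error is the tail, beyond `x ^ (K - 1)`, of an expansion in powers of
`x = 1 / n`. -/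
theorem exists_norm_bernoulliError_le {K : ℕ} (hK : 2 ≤ K) (R : ℝ) :
    ∃ C : ℝ, 0 ≤ C ∧ ∀ w : ℂ, ‖w‖ ≤ R → ∀ n : ℕ, n ≠ 0 →
      ‖bernoulliError K w n‖ ≤ C * (n : ℝ) ^ (w.re - K) := by
  have hbd : ∀ j : ℕ, ∃ D : ℝ, 0 ≤ D ∧ ∀ w : ℂ, ‖w‖ ≤ R →
      ‖Ring.choose w j * (bernoulli j : ℂ)‖ ≤ D := by
    intro j
    obtain ⟨D, hD⟩ := (isCompact_closedBall (0 : ℂ) R).exists_bound_of_continuousOn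
      ((differentiable_choose j).continuous.mul
        (continuous_const (y := (bernoulli j : ℂ)))).continuousOn
    exact ⟨|D|, abs_nonneg D, fun w hw => (hD w (by simpa using hw)).trans (le_abs_self D)⟩
  choose D hD0 hD using hbd
  choose C hC0 hC using fun j : ℕ => exists_norm_one_add_cpow_sub_sum_le (K - j) (R + j)
  refine ⟨∑ j ∈ Finset.range K, D j * C j,
    Finset.sum_nonneg fun j _ => mul_nonneg (hD0 j) (hC0 j), fun w hw n hn => ?_⟩
  have hn0 : (0 : ℝ) < n := by positivity
  have hn1 : (n : ℝ)⁻¹ ≤ 1 :=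
    inv_le_one_of_one_le₀ (by exact_mod_cast Nat.one_le_iff_ne_zero.2 hn)
  set x : ℝ := (n : ℝ)⁻¹ with hx
  have hx0 : 0 ≤ x := by positivity
  have hxn : (n : ℂ)⁻¹ = (x : ℂ) := by rw [hx]; push_cast; rfl
  have hsum : ∑ j ∈ Finset.range K, Ring.choose w j * (bernoulli j : ℂ) * (x : ℂ) ^ j *
        ((1 + (x : ℂ)) ^ (w - j) - 1) - w * x =
      ∑ j ∈ Finset.range K, Ring.choose w j * (bernoulli j : ℂ) * (x : ℂ) ^ j *
        ((1 + (x : ℂ)) ^ (w - j) -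
          ∑ i ∈ Finset.range (K - j), Ring.choose (w - j) i * (x : ℂ) ^ i) := by
    simp only [mul_sub, Finset.sum_sub_distrib, sum_choose_bernoulli_flip hK, mul_one]
    ring
  rw [bernoulliError_eq K w hn, hxn, ← hx, hsum, norm_mul, ← Complex.ofReal_natCast,
    Complex.norm_cpow_eq_rpow_re_of_pos hn0, Real.rpow_sub hn0, Real.rpow_natCast, mul_div_assoc',
    mul_comm, mul_div_right_comm]
  refine mul_le_mul_of_nonneg_right ?_ (by positivity)
  rw [div_eq_mul_inv, ← inv_pow, ← hx, Finset.sum_mul]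
  refine (norm_sum_le _ _).trans (Finset.sum_le_sum fun j hj => ?_)
  have hjK : j ≤ K := (Finset.mem_range.1 hj).le
  have hwj : ‖w - j‖ ≤ R + j := (norm_sub_le _ _).trans (by simpa using hw)
  rw [norm_mul, norm_mul, norm_pow, Complex.norm_of_nonneg hx0]
  calc _ ≤ D j * x ^ j * (C j * x ^ (K - j)) := by
        gcongr
        · have := hD0 j
          positivity
        · exact hD j w hw
        · exact hC j _ hwj x hx0 hn1
    _ = _ := by rw [← pow_sub_mul_pow x hjK]; ring

/-- At a natural number `p` the sum terminates, and the truncation is the Bernoulli polynomial. -/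
theorem bernoulliError_natCast {K p : ℕ} (hp : p < K) (hp0 : p ≠ 0) {n : ℕ} (hn : n ≠ 0) :
    bernoulliError K p n = 0 := by
  have hK : 2 ≤ K := by lia
  have hterm : ∀ j ∈ Finset.range K, Ring.choose (p : ℂ) j * (bernoulli j : ℂ) *
      ((n : ℂ)⁻¹) ^ j * (1 + ((n : ℝ)⁻¹ : ℝ) : ℂ) ^ ((p : ℂ) - j) =
      Ring.choose (p : ℂ) j * (bernoulli j : ℂ) * ((n : ℂ)⁻¹) ^ j *
        ∑ i ∈ Finset.range (K - j), Ring.choose ((p : ℂ) - j) i * ((n : ℂ)⁻¹) ^ i := by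
    intro j hj
    have hjK := Finset.mem_range.1 hj
    rcases lt_or_ge p j with h | h
    · simp [Ring.choose_natCast, Nat.choose_eq_zero_of_lt h]
    · congr 1
      rw [← Nat.cast_sub h, Complex.cpow_natCast, add_comm, add_pow]
      have hsub : Finset.range (p - j + 1) ⊆ Finset.range (K - j) := by
        intro i hi
        simp only [Finset.mem_range] at hi ⊢
        lia
      rw [← Finset.sum_subset hsub fun i _ hi => ?_]
      · refine Finset.sum_congr rfl fun i _ => ?_
        simp [Ring.choose_natCast, mul_comm]
      · rw [Ring.choose_natCast, Nat.choose_eq_zero_of_lt, Nat.cast_zero, zero_mul]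
        simp only [Finset.mem_range] at hi
        lia
  rw [bernoulliError_eq K _ hn]
  simp only [mul_sub, mul_one, Finset.sum_sub_distrib]
  rw [Finset.sum_congr rfl hterm, sum_choose_bernoulli_flip hK]
  ring

theorem differentiable_bernoulliError (K : ℕ) {n : ℕ} (hn : n ≠ 0) :
    Differentiable ℂ fun w => bernoulliError K w n := by
  have h1 : (n : ℂ) + 1 ≠ 0 := by exact_mod_cast Nat.succ_ne_zero n
  have h2 : (n : ℂ) ≠ 0 := Nat.cast_ne_zero.2 hn
  have h3 : ∀ x : ℂ, x ≠ 0 → Differentiable ℂ fun w => truncBernoulli K w x := by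
    intro x hx
    unfold truncBernoulli
    refine Differentiable.fun_sum fun j _ => ?_
    refine ((differentiable_choose j).mul (differentiable_const _)).mul fun w => ?_
    exact (DifferentiableAt.sub_const differentiableAt_id _).const_cpow (.inl hx)
  unfold bernoulliError
  refine ((h3 _ h1).sub (h3 _ h2)).sub (differentiable_id.mul fun w => ?_)
  exact (DifferentiableAt.sub_const differentiableAt_id _).const_cpow (.inl h2)

/-! ### Dirichlet series with coefficients `H_n ^ m` -/

theorem harmonic_nonneg (n : ℕ) : 0 ≤ harmonic n :=
  Finset.sum_nonneg fun _ _ => by positivity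

theorem norm_harmonicPow (m n : ℕ) : ‖harmonicPow m n‖ = (harmonic n : ℝ) ^ m := by
  have h : (0 : ℝ) ≤ harmonic n := by exact_mod_cast harmonic_nonneg n
  rw [harmonicPow, norm_pow, ← Complex.ofReal_ratCast, Complex.norm_of_nonneg h]

theorem harmonic_le_self (n : ℕ) : harmonic n ≤ n := by
  induction n with
  | zero => simp
  | succ n ih =>
    rw [harmonic_succ]
    have : ((n + 1 : ℕ) : ℚ)⁻¹ ≤ 1 :=
      inv_le_one_of_one_le₀ (by push_cast; linarith [n.cast_nonneg (α := ℚ)])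
    push_cast at this ⊢
    linarith

theorem norm_harmonicPow_le (m n : ℕ) : ‖harmonicPow m n‖ ≤ (n : ℝ) ^ m := by
  rw [norm_harmonicPow]
  have h : (0 : ℝ) ≤ harmonic n := by exact_mod_cast harmonic_nonneg n
  have h' : (harmonic n : ℝ) ≤ n := by exact_mod_cast harmonic_le_self n
  gcongr

theorem harmonicPow_isBigO (m : ℕ) {ε : ℝ} (hε : 0 < ε) :
    harmonicPow m =O[atTop] fun n : ℕ => (n : ℝ) ^ ε := by
  have h1 : harmonicPow m =O[atTop] fun n : ℕ => (1 + Real.log n) ^ m := by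
    refine Asymptotics.isBigO_of_le _ fun n => ?_
    have h : (0 : ℝ) ≤ harmonic n := by exact_mod_cast harmonic_nonneg n
    have h' := harmonic_le_one_add_log n
    rw [norm_harmonicPow, norm_pow, Real.norm_of_nonneg (h.trans h')]
    gcongr
  refine h1.trans ?_
  have hlog : (fun x : ℝ => (1 + Real.log x) ^ m) =O[atTop] fun x => x ^ ε := by
    have h2 : (fun x : ℝ => 1 + Real.log x) =O[atTop] Real.log := by
      refine Asymptotics.IsBigO.add ?_ (Asymptotics.isBigO_refl _ _)
      exact (Real.isLittleO_const_log_atTop (c := 1)).isBigO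
    refine (h2.pow m).trans ?_
    simpa using (isLittleO_log_rpow_rpow_atTop (m : ℝ) hε).isBigO
  exact hlog.comp_tendsto tendsto_natCast_atTop_atTop

theorem lseriesSummable_harmonicPow (m : ℕ) {s : ℂ} (hs : 1 < s.re) :
    LSeriesSummable (harmonicPow m) s := by
  have h := harmonicPow_isBigO m (ε := (s.re - 1) / 2) (by linarith)
  refine LSeriesSummable_of_isBigO_rpow (x := (s.re - 1) / 2 + 1) (by linarith) ?_
  simpa using h

theorem analyticOnNhd_harmonicZeta (m : ℕ) :
    AnalyticOnNhd ℂ (harmonicZeta m) {s | 1 < s.re} := by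
  intro s hs
  refine LSeries_analyticOnNhd (harmonicPow m) s ?_
  have hs' : 1 < s.re := hs
  have h : LSeries.abscissaOfAbsConv (harmonicPow m) ≤ ((1 + s.re) / 2 : ℝ) := by
    simpa using (lseriesSummable_harmonicPow m
      (s := (((1 + s.re) / 2 : ℝ) : ℂ)) (by simp; linarith)).abscissaOfAbsConv_le
  exact h.trans_lt (by exact_mod_cast (by linarith : (1 + s.re) / 2 < s.re))

theorem hasSum_harmonicZeta (m : ℕ) {s : ℂ} (hs : 1 < s.re) :
    HasSum (fun n : ℕ => harmonicPow m (n + 1) * ((n : ℂ) + 1) ^ (-s)) (harmonicZeta m s) := by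
  have h := (hasSum_nat_add_iff' 1).2
    (LSeriesSummable.LSeriesHasSum (lseriesSummable_harmonicPow m hs))
  simp only [Finset.range_one, Finset.sum_singleton, LSeries.term_zero, sub_zero] at h
  refine h.congr_fun fun n => ?_
  rw [LSeries.term_of_ne_zero (Nat.succ_ne_zero n), Complex.cpow_neg, div_eq_mul_inv]
  push_cast
  rfl

/-- The remainder of the Euler–Maclaurin expansion of `(1 - s) ∑ H_n ^ m / n ^ s`; it converges
on the half-plane `m + 2 - K < re s`. -/
noncomputable def harmonicRemainder (m K : ℕ) (s : ℂ) : ℂ :=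
  ∑' n : ℕ, harmonicPow m (n + 1) * bernoulliError K (1 - s) (n + 1)

theorem exists_norm_harmonicRemainder_term_le (m : ℕ) {K : ℕ} (hK : 2 ≤ K) (R a : ℝ) :
    ∃ C : ℝ, ∀ s : ℂ, ‖s‖ ≤ R → a ≤ s.re → ∀ n : ℕ,
      ‖harmonicPow m (n + 1) * bernoulliError K (1 - s) (n + 1)‖ ≤
        C * ((n + 1 : ℕ) : ℝ) ^ (m + 1 - a - K) := by
  obtain ⟨C, hC, h⟩ := exists_norm_bernoulliError_le hK (1 + R)
  refine ⟨C, fun s hs ha n => ?_⟩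
  have hs' : ‖1 - s‖ ≤ 1 + R := (norm_sub_le _ _).trans (by simpa using hs)
  have hn : (1 : ℝ) ≤ ((n + 1 : ℕ) : ℝ) := by push_cast; linarith [n.cast_nonneg (α := ℝ)]
  have hn0 : (0 : ℝ) < ((n + 1 : ℕ) : ℝ) := by linarith
  rw [norm_mul]
  calc _ ≤ ((n + 1 : ℕ) : ℝ) ^ m * (C * ((n + 1 : ℕ) : ℝ) ^ ((1 - s).re - K)) :=
        mul_le_mul (norm_harmonicPow_le _ _) (h _ hs' _ (Nat.succ_ne_zero n)) (norm_nonneg _)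
          (by positivity)
    _ = C * ((n + 1 : ℕ) : ℝ) ^ ((m : ℝ) + ((1 - s).re - K)) := by
        rw [Real.rpow_add hn0, Real.rpow_natCast]; ring
    _ ≤ _ := by
        refine mul_le_mul_of_nonneg_left (Real.rpow_le_rpow_of_exponent_le hn ?_) hC
        simp only [Complex.sub_re, Complex.one_re]
        linarith

theorem summable_add_one_rpow {p : ℝ} (hp : p < -1) :
    Summable fun n : ℕ => ((n + 1 : ℕ) : ℝ) ^ p :=
  (summable_nat_add_iff 1).2 (Real.summable_nat_rpow.2 hp)

theorem summable_harmonicRemainder {m K : ℕ} (hK : 2 ≤ K) {s : ℂ} (hs : (m : ℝ) + 2 - K < s.re) :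
    Summable fun n : ℕ => harmonicPow m (n + 1) * bernoulliError K (1 - s) (n + 1) := by
  obtain ⟨C, h⟩ := exists_norm_harmonicRemainder_term_le m hK ‖s‖ s.re
  exact .of_norm_bounded ((summable_add_one_rpow (by linarith)).mul_left C)
    fun n => h s le_rfl le_rfl n

theorem analyticOnNhd_harmonicRemainder {m K : ℕ} (hK : 2 ≤ K) :
    AnalyticOnNhd ℂ (harmonicRemainder m K) {s | (m : ℝ) + 2 - K < s.re} := by
  intro s hs
  have hs' : (m : ℝ) + 2 - K < s.re := hs
  obtain ⟨a, ha, has⟩ := exists_between hs'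
  obtain ⟨C, h⟩ := exists_norm_harmonicRemainder_term_le m hK (‖s‖ + 1) a
  have hopen : IsOpen ({z : ℂ | a < z.re} ∩ {z | ‖z‖ < ‖s‖ + 1}) :=
    (isOpen_lt continuous_const Complex.continuous_re).inter
      (isOpen_lt continuous_norm continuous_const)
  refine (Complex.differentiableOn_tsum_of_summable_norm
    ((summable_add_one_rpow (p := m + 1 - a - K) (by linarith)).mul_left C) (fun n => ?_) hopen
    fun n z hz => h z hz.2.le hz.1.le n).analyticOnNhd hopen s ⟨has, by simp⟩
  have hd := (differentiable_bernoulliError K (Nat.succ_ne_zero n)).comp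
    ((differentiable_const (1 : ℂ)).sub differentiable_id)
  exact (hd.const_mul _).differentiableOn

/-- The remainder vanishes at `s = 1 - p`, where the Bernoulli expansion is exact. -/
theorem harmonicRemainder_one_sub_natCast {m K p : ℕ} (hp : p < K) (hp0 : p ≠ 0) :
    harmonicRemainder m K (1 - p) = 0 := by
  have h : ∀ n : ℕ, bernoulliError K (1 - (1 - (p : ℂ))) (n + 1) = 0 := fun n => by
    rw [sub_sub_cancel]
    exact bernoulliError_natCast hp hp0 (Nat.succ_ne_zero n)
  simp only [harmonicRemainder, h, mul_zero, tsum_zero]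

/-- The binomial expansion of `H_n ^ m = (H_{n + 1} - 1 / (n + 1)) ^ m`. -/
theorem harmonicPow_sub_harmonicPow_succ (M n : ℕ) :
    harmonicPow (M + 1) n - harmonicPow (M + 1) (n + 1) =
      ∑ i ∈ Finset.range (M + 1), (-1) ^ (i + 1) * ((M + 1).choose (i + 1) : ℂ) *
        (harmonicPow (M - i) (n + 1) * ((n : ℂ) + 1)⁻¹ ^ (i + 1)) := by
  have h : ((harmonic n : ℚ) : ℂ) = -((n : ℂ) + 1)⁻¹ + ((harmonic (n + 1) : ℚ) : ℂ) := by
    rw [harmonic_succ]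
    push_cast
    ring
  simp only [harmonicPow]
  rw [h, add_pow, Finset.sum_range_succ']
  simp only [pow_zero, one_mul, Nat.sub_zero, Nat.choose_zero_right, Nat.cast_one, mul_one,
    add_sub_cancel_right]
  refine Finset.sum_congr rfl fun i _ => ?_
  rw [Nat.succ_sub_succ, neg_pow]
  ring

theorem hasSum_harmonicPow_mul_truncBernoulli (m K i : ℕ) {s : ℂ} (hs : 1 < (s + i).re) :
    HasSum (fun n : ℕ => harmonicPow m (n + 1) * ((n : ℂ) + 1)⁻¹ ^ (i + 1) *
      truncBernoulli K (1 - s) (n + 1))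
      (∑ j ∈ Finset.range K, Ring.choose (1 - s) j * (bernoulli j : ℂ) *
        harmonicZeta m (s + i + j)) := by
  have h : ∀ j ∈ Finset.range K, HasSum (fun n : ℕ => Ring.choose (1 - s) j * (bernoulli j : ℂ) *
      (harmonicPow m (n + 1) * ((n : ℂ) + 1) ^ (-(s + i + j))))
      (Ring.choose (1 - s) j * (bernoulli j : ℂ) * harmonicZeta m (s + i + j)) := fun j _ =>
    (hasSum_harmonicZeta m (by
      have : (0 : ℝ) ≤ j := j.cast_nonneg
      simp only [Complex.add_re, Complex.natCast_re] at hs ⊢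
      linarith)).mul_left _
  refine (hasSum_sum h).congr_fun fun n => ?_
  have hn : (n : ℂ) + 1 ≠ 0 := by exact_mod_cast Nat.succ_ne_zero n
  rw [truncBernoulli, Finset.mul_sum]
  refine Finset.sum_congr rfl fun j _ => ?_
  rw [show 1 - s - (j : ℂ) = -(s + i + j) + ((i + 1 : ℕ) : ℂ) by push_cast; ring,
    Complex.cpow_add _ _ hn, Complex.cpow_natCast, inv_pow]
  field_simp

/-- Summation by parts: `(1 - s) n ^ (-s)` is, up to the Bernoulli error, the difference
`B_{1 - s}(n + 1) - B_{1 - s}(n)`, and the differences of `H_n ^ (M + 1)` involve only lower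
powers of `H_n`. -/
theorem one_sub_mul_harmonicZeta {M K : ℕ} (hK : M + 3 ≤ K) {s : ℂ} (hs : 2 < s.re) :
    (1 - s) * harmonicZeta (M + 1) s =
      (∑ i ∈ Finset.range (M + 1), (-1) ^ (i + 1) * ((M + 1).choose (i + 1) : ℂ) *
        ∑ j ∈ Finset.range K, Ring.choose (1 - s) j * (bernoulli j : ℂ) *
          harmonicZeta (M - i) (s + i + j)) - harmonicRemainder (M + 1) K s := by
  have hK' : (M : ℝ) + 3 ≤ K := by exact_mod_cast hK
  set E : ℕ → ℂ := fun n => truncBernoulli K (1 - s) n with hE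
  have hrem := (summable_harmonicRemainder (m := M + 1) (by lia : 2 ≤ K) (s := s)
    (by push_cast; linarith)).hasSum
  have hzeta := (hasSum_harmonicZeta (M + 1) (by linarith : 1 < s.re)).mul_left (1 - s)
  -- the sum of `H_n ^ (M + 1) * B(n)`, over `n ≥ 1`
  have hb : Summable fun n : ℕ => harmonicPow (M + 1) (n + 1) * E (n + 1) := by
    have h : ∀ j ∈ Finset.range K, Summable fun n : ℕ =>
        Ring.choose (1 - s) j * (bernoulli j : ℂ) *
          (harmonicPow (M + 1) (n + 1) * ((n : ℂ) + 1) ^ (-(s - 1 + j))) := fun j _ =>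
      ((hasSum_harmonicZeta (M + 1) (by
        have : (0 : ℝ) ≤ j := j.cast_nonneg
        simp only [Complex.add_re, Complex.sub_re, Complex.one_re, Complex.natCast_re]
        linarith)).mul_left _).summable
    refine (summable_sum h).congr fun n => ?_
    rw [hE]
    simp only [truncBernoulli, Finset.mul_sum]
    refine Finset.sum_congr rfl fun j _ => ?_
    rw [show 1 - s - (j : ℂ) = -(s - 1 + j) by ring]
    push_cast
    ring
  have hab : HasSum (fun n : ℕ => harmonicPow (M + 1) (n + 1) * E (n + 2) -
      harmonicPow (M + 1) (n + 1) * E (n + 1))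
      ((1 - s) * harmonicZeta (M + 1) s + harmonicRemainder (M + 1) K s) := by
    refine (hzeta.add hrem).congr_fun fun n => ?_
    rw [hE]
    simp only [bernoulliError]
    rw [show 1 - s - 1 = -s by ring, show ((n + 2 : ℕ) : ℂ) = ((n + 1 : ℕ) : ℂ) + 1 by
      push_cast; ring, show ((n : ℂ) + 1) = ((n + 1 : ℕ) : ℂ) by push_cast; rfl]
    ring
  -- the sum of `H_n ^ (M + 1) * B(n + 1)`, over `n ≥ 1` and over `n ≥ 0`, as `H_0 = 0`
  have ha : Summable fun n : ℕ => harmonicPow (M + 1) (n + 1) * E (n + 2) := by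
    simpa using hab.summable.add hb
  have ha' : HasSum (fun n : ℕ => harmonicPow (M + 1) n * E (n + 1))
      (∑' n : ℕ, harmonicPow (M + 1) (n + 1) * E (n + 2)) := by
    have := (hasSum_nat_add_iff
      (f := fun n : ℕ => harmonicPow (M + 1) n * E (n + 1)) 1).1 ha.hasSum
    simpa [harmonicPow] using this
  have hparts := ha'.sub hb.hasSum
  rw [← ha.tsum_sub hb, hab.tsum_eq] at hparts
  have hdiff : HasSum (fun n : ℕ => harmonicPow (M + 1) n * E (n + 1) -
      harmonicPow (M + 1) (n + 1) * E (n + 1))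
      (∑ i ∈ Finset.range (M + 1), (-1) ^ (i + 1) * ((M + 1).choose (i + 1) : ℂ) *
        ∑ j ∈ Finset.range K, Ring.choose (1 - s) j * (bernoulli j : ℂ) *
          harmonicZeta (M - i) (s + i + j)) := by
    have h : ∀ i ∈ Finset.range (M + 1), HasSum (fun n : ℕ =>
        (-1) ^ (i + 1) * ((M + 1).choose (i + 1) : ℂ) *
        (harmonicPow (M - i) (n + 1) * ((n : ℂ) + 1)⁻¹ ^ (i + 1) *
          truncBernoulli K (1 - s) (n + 1))) _ := fun i _ =>
      (hasSum_harmonicPow_mul_truncBernoulli (M - i) K i (s := s) (by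
        have : (0 : ℝ) ≤ i := i.cast_nonneg
        simp only [Complex.add_re, Complex.natCast_re]
        linarith)).mul_left _
    refine (hasSum_sum h).congr_fun fun n => ?_
    rw [← sub_mul, harmonicPow_sub_harmonicPow_succ, Finset.sum_mul]
    refine Finset.sum_congr rfl fun i _ => ?_
    rw [hE]
    push_cast
    ring
  linear_combination hparts.unique hdiff

/-! ### Gluing meromorphic functions on half-planes -/

/-- The identity theorem for meromorphic functions on a half-plane. -/
theorem MeromorphicOn.eventuallyEq_of_eq_of_lt_re {g h : ℂ → ℂ} {b c : ℝ}
    (hg : MeromorphicOn g {s | b < s.re}) (hh : MeromorphicOn h {s | b < s.re})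
    (heq : ∀ s : ℂ, c < s.re → g s = h s) {z : ℂ} (hz : b < z.re) : g =ᶠ[𝓝[≠] z] h := by
  have hsub : MeromorphicOn (g - h) {s | b < s.re} := hg.sub hh
  have hconn : IsPreconnected {s : ℂ | b < s.re} := (convex_halfSpace_re_gt b).isPreconnected
  have htop : meromorphicOrderAt (g - h) z = ⊤ := by
    by_contra hne
    have hy : (((max b c + 1 : ℝ) : ℂ)) ∈ {s : ℂ | b < s.re} := by
      simp only [Set.mem_ofPred_eq, Complex.ofReal_re]
      linarith [le_max_left b c]
    refine hsub.meromorphicOrderAt_ne_top_of_isPreconnected hconn hz hy hne ?_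
    rw [meromorphicOrderAt_eq_top_iff]
    have hopen : IsOpen {s : ℂ | c < s.re} := isOpen_lt continuous_const Complex.continuous_re
    filter_upwards [nhdsWithin_le_nhds (hopen.mem_nhds (by
      simp only [Set.mem_ofPred_eq, Complex.ofReal_re]
      linarith [le_max_right b c]))] with s hs
    simp [heq s hs]
  rw [meromorphicOrderAt_eq_top_iff] at htop
  filter_upwards [htop] with s hs using sub_eq_zero.1 hs

/-- Functions that are meromorphic on the half-planes `-k < re s` and agree with a given analytic
function far to the right glue to a meromorphic function on `ℂ`, in normal form. -/
theorem exists_meromorphicNFAt_glue {f : ℂ → ℂ} (hf : AnalyticOnNhd ℂ f {s | 1 < s.re})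
    (A : ℕ → ℂ → ℂ) (hA : ∀ k : ℕ, MeromorphicOn (A k) {s | -(k : ℝ) < s.re})
    (hAf : ∀ (k : ℕ) (s : ℂ), 2 < s.re → A k s = f s) :
    ∃ F : ℂ → ℂ, (∀ z, MeromorphicNFAt F z) ∧ (∀ s : ℂ, 1 < s.re → F s = f s) ∧
      ∀ (k : ℕ) (z : ℂ), -(k : ℝ) < z.re → F =ᶠ[𝓝[≠] z] A k := by
  have hopen : ∀ k : ℕ, IsOpen {s : ℂ | -(k : ℝ) < s.re} := fun k =>
    isOpen_lt continuous_const Complex.continuous_re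
  have hAA : ∀ (k l : ℕ) (z : ℂ), -(k : ℝ) < z.re → -(l : ℝ) < z.re → A k =ᶠ[𝓝[≠] z] A l := by
    intro k l z hk hl
    refine MeromorphicOn.eventuallyEq_of_eq_of_lt_re (b := max (-(k : ℝ)) (-(l : ℝ))) (c := 2)
      ((hA k).mono_set fun s hs =>
        lt_of_le_of_lt (b := max (-(k : ℝ)) (-(l : ℝ))) (le_max_left _ _) hs)
      ((hA l).mono_set fun s hs =>
        lt_of_le_of_lt (b := max (-(k : ℝ)) (-(l : ℝ))) (le_max_right _ _) hs)
      (fun s hs => by rw [hAf k s hs, hAf l s hs]) (max_lt hk hl)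
  have hAf' : ∀ (k : ℕ) (z : ℂ), 1 < z.re → A k =ᶠ[𝓝[≠] z] f := by
    intro k z hz
    have hk : (0 : ℝ) ≤ k := k.cast_nonneg
    refine MeromorphicOn.eventuallyEq_of_eq_of_lt_re (b := 1) (c := 2)
      ((hA k).mono_set fun s hs => ?_) hf.meromorphicOn (hAf k) hz
    have : 1 < s.re := hs
    show -(k : ℝ) < s.re
    linarith
  -- every `z` lies in the half-plane with this index, which is used to define the value at `z`
  have hex : ∀ z : ℂ, -((⌈‖z‖⌉₊ + 1 : ℕ) : ℝ) < z.re := by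
    intro z
    have h1 := Nat.le_ceil ‖z‖
    have h2 := (abs_le.1 (Complex.abs_re_le_norm z)).1
    push_cast
    linarith
  -- the value at `z` of the normal form does not depend on the half-plane
  set F : ℂ → ℂ := fun z => toMeromorphicNFAt (A (⌈‖z‖⌉₊ + 1)) z z with hF
  have hFA : ∀ (k : ℕ) (z : ℂ), -(k : ℝ) < z.re →
      F =ᶠ[𝓝 z] toMeromorphicNFOn (A k) {s | -(k : ℝ) < s.re} := by
    intro k z hz
    filter_upwards [(hopen k).mem_nhds hz] with y hy
    rw [toMeromorphicNFOn_eq_toMeromorphicNFAt (hA k) hy]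
    exact (toMeromorphicNFAt_eventuallyEq_nhds_congr (hAA _ k y (hex y) hy)).eq_of_nhds
  refine ⟨F, fun z => ?_, fun s hs => ?_, fun k z hz => ?_⟩
  · rw [meromorphicNFAt_congr (hFA _ z (hex z))]
    exact meromorphicNFOn_toMeromorphicNFOn _ _ (hex z)
  · have h := (toMeromorphicNFAt_eventuallyEq_nhds_congr (hAf' (⌈‖s‖⌉₊ + 1) s hs)).eq_of_nhds
    rw [toMeromorphicNFAt_eq_self.2 (hf s hs).meromorphicNFAt] at h
    exact h
  · exact ((hFA k z hz).filter_mono nhdsWithin_le_nhds).trans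
      ((hA k).toMeromorphicNFOn_eq_self_on_nhdsNE hz)

/-! ### Leading coefficients at a pole -/

/-- `(s - z) ^ e * F s` tends to `c` as `s → z`, where `c = 0` is allowed: if `F` is meromorphic,
its order at `z` is at least `-e`, and `c` is the coefficient of `(s - z) ^ (-e)`. -/
def HasPoleCoeff (F : ℂ → ℂ) (z : ℂ) (e : ℤ) (c : ℂ) : Prop :=
  Tendsto (fun s => (s - z) ^ e * F s) (𝓝[≠] z) (𝓝 c)

namespace HasPoleCoeff

variable {F G : ℂ → ℂ} {z c d : ℂ} {e : ℤ}

theorem congr (h : HasPoleCoeff F z e c) (hFG : F =ᶠ[𝓝[≠] z] G) : HasPoleCoeff G z e c :=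
  Tendsto.congr' (hFG.mono fun s hs => by rw [hs]) h

theorem eventually_ne (z : ℂ) : ∀ᶠ s in 𝓝[≠] z, s - z ≠ 0 := by
  filter_upwards [self_mem_nhdsWithin] with s hs using sub_ne_zero.2 hs

theorem of_lt {e' : ℤ} (h : HasPoleCoeff F z e c) (he : e < e') : HasPoleCoeff F z e' 0 := by
  have h0 : Tendsto (fun s => (s - z) ^ (e' - e)) (𝓝[≠] z) (𝓝 0) := by
    lift e' - e to ℕ using by lia with n hn
    have hn0 : n ≠ 0 := by lia
    have hc : Tendsto (fun s : ℂ => (s - z) ^ n) (𝓝 z) (𝓝 ((z - z) ^ n)) :=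
      (Continuous.tendsto (by fun_prop) z)
    rw [sub_self, zero_pow hn0] at hc
    simpa using hc.mono_left nhdsWithin_le_nhds
  have h1 := h0.mul h
  rw [zero_mul] at h1
  refine h1.congr' ?_
  filter_upwards [eventually_ne z] with s hs
  rw [← mul_assoc, ← zpow_add₀ hs, sub_add_cancel]

theorem const_mul_of_continuousAt {g : ℂ → ℂ} (h : HasPoleCoeff F z e c)
    (hg : ContinuousAt g z) : HasPoleCoeff (fun s => g s * F s) z e (g z * c) := by
  refine ((hg.tendsto.mono_left nhdsWithin_le_nhds).mul h).congr fun s => ?_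
  ring

theorem sub (hF : HasPoleCoeff F z e c) (hG : HasPoleCoeff G z e d) :
    HasPoleCoeff (fun s => F s - G s) z e (c - d) :=
  (Tendsto.sub hF hG).congr fun s => by ring

theorem sum {ι : Type*} {t : Finset ι} {F : ι → ℂ → ℂ} {c : ι → ℂ}
    (h : ∀ i ∈ t, HasPoleCoeff (F i) z e (c i)) :
    HasPoleCoeff (fun s => ∑ i ∈ t, F i s) z e (∑ i ∈ t, c i) :=
  (tendsto_finsetSum t h).congr fun s => by rw [Finset.mul_sum]

theorem of_continuousAt (h : ContinuousAt F z) : HasPoleCoeff F z 0 (F z) := by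
  simpa [HasPoleCoeff] using h.tendsto.mono_left nhdsWithin_le_nhds

theorem of_continuousAt_of_pos (h : ContinuousAt F z) (he : 0 < e) : HasPoleCoeff F z e 0 :=
  (of_continuousAt h).of_lt he

theorem of_continuousAt_of_eq_zero (h : ContinuousAt F z) (hz : F z = 0) (he : 0 ≤ e) :
    HasPoleCoeff F z e 0 := by
  rcases he.eq_or_lt with rfl | he
  · simpa [hz] using of_continuousAt h
  · exact of_continuousAt_of_pos h he

theorem comp_add_const {a : ℂ} (h : HasPoleCoeff F (z + a) e c) :
    HasPoleCoeff (fun s => F (s + a)) z e c := by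
  have ht : Tendsto (fun s => s + a) (𝓝[≠] z) (𝓝[≠] (z + a)) := by
    refine tendsto_nhdsWithin_iff.2 ⟨(Continuous.tendsto (by fun_prop) z).mono_left
      nhdsWithin_le_nhds, ?_⟩
    filter_upwards [self_mem_nhdsWithin] with s hs
    simpa using hs
  refine (Tendsto.comp h ht).congr fun s => ?_
  simp

theorem meromorphicOrderAt_eq (h : HasPoleCoeff F z e c) (hc : c ≠ 0)
    (hF : MeromorphicAt F z) : meromorphicOrderAt F z = ((-e : ℤ) : WithTop ℤ) := by
  have hid : MeromorphicAt (fun s : ℂ => s - z) z := by fun_prop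
  have hz : MeromorphicAt (fun s : ℂ => (s - z) ^ e) z := hid.fun_zpow e
  have h0 : meromorphicOrderAt (fun s => (s - z) ^ e * F s) z = 0 :=
    (tendsto_ne_zero_iff_meromorphicOrderAt_eq_zero (hz.fun_mul hF)).1 ⟨c, hc, h⟩
  rw [fun_meromorphicOrderAt_mul hz hF, fun_meromorphicOrderAt_zpow_id_sub_const] at h0
  cases ho : meromorphicOrderAt F z with
  | top => simp [ho] at h0
  | coe n =>
    rw [ho] at h0
    have h1 : e + n = 0 := by exact_mod_cast h0
    congr 1
    lia

end HasPoleCoeff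

/-! ### The continuations and the case `m = 0` -/

/-- The order of the pole of the continuation of `harmonicZeta m` at `1 - N` is (at most)
`m + poleShift N`. -/
def poleShift (N : ℕ) : ℤ := if N = 0 then 1 else if N = 1 ∨ Even N then 0 else -1

theorem poleShift_le_zero {N : ℕ} (hN : N ≠ 0) : poleShift N ≤ 0 := by
  unfold poleShift
  split_ifs <;> simp_all

theorem poleShift_le_one (N : ℕ) : poleShift N ≤ 1 := by
  unfold poleShift
  split_ifs <;> simp

theorem poleShift_of_odd {N : ℕ} (hN : Odd N) (h1 : N ≠ 1) : poleShift N = -1 := by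
  have h0 : N ≠ 0 := by rintro rfl; simp at hN
  simp [poleShift, h0, h1, Nat.not_even_iff_odd.2 hN]

/-- `F` is the meromorphic continuation, in normal form, of `∑ H_n ^ m / n ^ s`, together with its
leading coefficients at the points `1 - N`, as far as they are needed to pass to higher `m`. For
`m = 0` the function is `ζ`, with the exceptional value `ζ 0 = -1/2` in `coeff_one`. -/
structure IsHarmonicContinuation (m : ℕ) (F : ℂ → ℂ) : Prop where
  nf : ∀ z, MeromorphicNFAt F z
  eq : ∀ s : ℂ, 1 < s.re → F s = harmonicZeta m s
  analytic : ∀ z : ℂ, (∀ n : ℕ, z ≠ 1 - (n : ℂ)) → AnalyticAt ℂ F z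
  coeff : ∀ N : ℕ, ∃ c, HasPoleCoeff F (1 - N) (m + poleShift N) c
  coeff_zero : HasPoleCoeff F (1 - (0 : ℕ)) (m + 1) (m.factorial : ℂ)
  coeff_one : HasPoleCoeff F (1 - (1 : ℕ)) m (if m = 0 then -1 / 2 else (m.factorial : ℂ) / 2)
  coeff_even : ∀ N : ℕ, N ≠ 0 → Even N →
    HasPoleCoeff F (1 - N) m (-(m.factorial * (bernoulli N : ℂ) / N))
  coeff_odd : m ≠ 0 → ∀ N : ℕ, N ≠ 1 → Odd N → ∃ c, c ≠ 0 ∧ HasPoleCoeff F (1 - N) (m - 1) c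

theorem bernoulli_ne_zero_of_even {N : ℕ} (hN : Even N) : (bernoulli N : ℂ) ≠ 0 := by
  obtain ⟨k, rfl⟩ := hN
  rcases eq_or_ne k 0 with rfl | hk
  · simp
  intro h
  have h1 := riemannZeta_two_mul_nat hk
  rw [two_mul k, h, mul_zero, zero_div] at h1
  refine riemannZeta_ne_zero_of_one_lt_re ?_ h1
  have : (1 : ℝ) ≤ k := by exact_mod_cast Nat.one_le_iff_ne_zero.2 hk
  have h2 : (1 : ℝ) < 2 * k := by linarith
  simpa using h2

theorem one_sub_natCast_ne_one {N : ℕ} (hN : N ≠ 0) : (1 : ℂ) - N ≠ 1 := by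
  simpa using hN

theorem harmonicZeta_zero {s : ℂ} (hs : 1 < s.re) : harmonicZeta 0 s = riemannZeta s := by
  rw [harmonicZeta, ← LSeries_one_eq_riemannZeta hs]
  exact congrArg (LSeries · s) (funext fun n => by simp [harmonicPow])

theorem meromorphicAt_riemannZeta (z : ℂ) : MeromorphicAt riemannZeta z := by
  rcases eq_or_ne z 1 with rfl | hz
  -- the factor is `(s - 1) ^ 2`, as `(s - 1) * ζ s` tends to `1` but takes the value `0` at `s = 1`
  · refine ⟨2, Complex.analyticAt_of_differentiable_on_punctured_nhds_of_continuousAt ?_ ?_⟩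
    · filter_upwards [self_mem_nhdsWithin] with s hs
      exact ((differentiableAt_id.sub_const 1).pow 2).smul (differentiableAt_riemannZeta hs)
    · rw [continuousAt_iff_punctured_nhds]
      have h := HasPoleCoeff.of_lt (F := riemannZeta) (z := 1) (e := 1) (e' := 2)
        (by simpa [HasPoleCoeff] using riemannZeta_residue_one) one_lt_two
      simpa [HasPoleCoeff] using h
  · exact (analyticOn_riemannZeta z hz).meromorphicAt

theorem exists_isHarmonicContinuation_zero : ∃ F, IsHarmonicContinuation 0 F := by
  obtain ⟨F, hnf, heq, hF⟩ := exists_meromorphicNFAt_glue (analyticOnNhd_harmonicZeta 0)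
    (fun _ => riemannZeta) (fun _ z _ => meromorphicAt_riemannZeta z)
    (fun _ s hs => (harmonicZeta_zero (by linarith)).symm)
  have hF' : ∀ z, riemannZeta =ᶠ[𝓝[≠] z] F := fun z => by
    obtain ⟨k, hk⟩ := exists_nat_gt (-z.re)
    exact (hF k z (by linarith)).symm
  have hcont : ∀ N : ℕ, N ≠ 0 → HasPoleCoeff F (1 - N) 0 (riemannZeta (1 - N)) := fun N hN =>
    (HasPoleCoeff.of_continuousAt
      (differentiableAt_riemannZeta (one_sub_natCast_ne_one hN)).continuousAt).congr (hF' _)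
  have hval : ∀ N : ℕ, N ≠ 0 →
      riemannZeta (1 - N) = (-1) ^ (N - 1) * (bernoulli N : ℂ) / N := fun N hN => by
    obtain ⟨k, rfl⟩ := Nat.exists_eq_succ_of_ne_zero hN
    have := riemannZeta_neg_nat_eq_bernoulli k
    rw [show (1 : ℂ) - (k.succ : ℕ) = -k by push_cast; ring, this]
    simp
  have hone : HasPoleCoeff F (1 - (0 : ℕ)) 1 1 := by
    refine HasPoleCoeff.congr ?_ (hF' _)
    simpa [HasPoleCoeff] using riemannZeta_residue_one
  refine ⟨F, hnf, heq, fun z hz => ?_, fun N => ?_, by simpa using hone, ?_, fun N hN hev => ?_,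
    fun h => absurd rfl h⟩
  · have h1 : z ≠ 1 := by simpa using hz 0
    have han := analyticOn_riemannZeta z h1
    rw [← (hnf z).meromorphicOrderAt_nonneg_iff_analyticAt, ← meromorphicOrderAt_congr (hF' z)]
    exact han.meromorphicOrderAt_nonneg
  · rcases eq_or_ne N 0 with rfl | hN
    · exact ⟨1, by simpa [poleShift] using hone⟩
    by_cases h : N = 1 ∨ Even N
    · exact ⟨_, by simpa [poleShift, hN, h] using hcont N hN⟩
    · push Not at h
      have hodd := Nat.not_even_iff_odd.1 h.2
      have hz : riemannZeta (1 - N) = 0 := by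
        rw [hval N hN, bernoulli_eq_zero_of_odd hodd (by lia)]
        simp
      -- `ζ` vanishes at the negative even integers, so that a pole of order at most `-1` is right
      refine ⟨deriv riemannZeta (1 - N), HasPoleCoeff.congr ?_ (hF' _)⟩
      have hd := (differentiableAt_riemannZeta (one_sub_natCast_ne_one hN)).hasDerivAt
      rw [hasDerivAt_iff_tendsto_slope] at hd
      refine hd.congr fun s => ?_
      rw [poleShift_of_odd hodd h.1, slope_def_field, hz]
      simp [div_eq_inv_mul]
  · have := hcont 1 one_ne_zero
    rw [hval 1 one_ne_zero] at this
    simpa using this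
  · have := hcont N hN
    rw [hval N hN, Odd.neg_one_pow (Nat.Even.sub_odd (by lia) hev odd_one)] at this
    convert this using 1
    simp
    ring

/-! ### The induction step -/

namespace IsHarmonicContinuation

variable {m : ℕ} {F : ℂ → ℂ}

theorem coeff_shift (hF : IsHarmonicContinuation m F) {N d : ℕ} (hd : d ≤ N) :
    ∃ c, HasPoleCoeff (fun s => F (s + d)) (1 - N) (m + poleShift (N - d)) c := by
  obtain ⟨c, hc⟩ := hF.coeff (N - d)
  refine ⟨c, HasPoleCoeff.comp_add_const ?_⟩
  rwa [show (1 : ℂ) - N + d = 1 - (N - d : ℕ) by push_cast [hd]; ring]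

theorem analyticAt_shift (hF : IsHarmonicContinuation m F) {N d : ℕ} (hd : N < d) :
    AnalyticAt ℂ (fun s => F (s + d)) (1 - N) := by
  refine AnalyticAt.fun_comp (hF.analytic _ fun n hn => ?_) (by fun_prop)
  have h : ((d + n : ℕ) : ℂ) = (N : ℕ) := by push_cast; linear_combination hn
  have := Nat.cast_injective h
  lia

end IsHarmonicContinuation

/-- The coefficient of the `(i, j)` term of the Euler–Maclaurin expansion. Here `i` counts from
`0`: the term contains the power `M - i` of `H_n`, for the exponent `M + 1`. -/
noncomputable def harmonicTermCoeff (M i j : ℕ) (s : ℂ) : ℂ :=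
  (-1) ^ (i + 1) * ((M + 1).choose (i + 1) : ℂ) * (Ring.choose (1 - s) j * (bernoulli j : ℂ))

theorem differentiable_harmonicTermCoeff (M i j : ℕ) :
    Differentiable ℂ (harmonicTermCoeff M i j) := by
  unfold harmonicTermCoeff
  exact (((differentiable_choose j).comp
    ((differentiable_const (1 : ℂ)).sub differentiable_id)).mul_const _).const_mul _

theorem harmonicTermCoeff_one_sub (M i j N : ℕ) : harmonicTermCoeff M i j (1 - N) =
    (-1) ^ (i + 1) * ((M + 1).choose (i + 1) : ℂ) * ((N.choose j : ℂ) * (bernoulli j : ℂ)) := by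
  simp [harmonicTermCoeff, Ring.choose_natCast]

/-- The Euler–Maclaurin expansion of `(1 - s) ∑ H_n ^ (M + 1) / n ^ s` in terms of continuations
`F i` of the series for the exponents `i ≤ M`. -/
noncomputable def harmonicExpansion (F : ℕ → ℂ → ℂ) (M K : ℕ) (s : ℂ) : ℂ :=
  (∑ i ∈ Finset.range (M + 1), ∑ j ∈ Finset.range K,
    harmonicTermCoeff M i j s * F (M - i) (s + (i + j : ℕ))) - harmonicRemainder (M + 1) K s

section Step

variable {F : ℕ → ℂ → ℂ} {M : ℕ} (hF : ∀ i ≤ M, IsHarmonicContinuation i (F i))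
include hF

theorem harmonicExpansion_eq {K : ℕ} (hK : M + 3 ≤ K) {s : ℂ} (hs : 2 < s.re) :
    harmonicExpansion F M K s = (1 - s) * harmonicZeta (M + 1) s := by
  rw [one_sub_mul_harmonicZeta hK hs, harmonicExpansion]
  congr 1
  refine Finset.sum_congr rfl fun i _ => ?_
  rw [Finset.mul_sum]
  refine Finset.sum_congr rfl fun j _ => ?_
  have h : 1 < (s + (i + j : ℕ)).re := by
    have : (0 : ℝ) ≤ (i + j : ℕ) := Nat.cast_nonneg _
    simp only [Complex.add_re, Complex.natCast_re]
    linarith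
  rw [(hF (M - i) (Nat.sub_le _ _)).eq _ h, harmonicTermCoeff, Nat.cast_add, add_assoc]
  ring

theorem analyticAt_harmonicExpansion {K : ℕ} (hK : 2 ≤ K) {z : ℂ}
    (hzK : (M : ℝ) + 3 - K < z.re) (hz : ∀ n : ℕ, z ≠ 1 - (n : ℂ)) :
    AnalyticAt ℂ (harmonicExpansion F M K) z := by
  have hrem := analyticOnNhd_harmonicRemainder (m := M + 1) hK z
    (show ((M + 1 : ℕ) : ℝ) + 2 - K < z.re by push_cast; linarith)
  refine (Finset.analyticAt_fun_sum _ fun i _ => Finset.analyticAt_fun_sum _ fun j _ =>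
    ((differentiable_harmonicTermCoeff M i j).analyticAt z).mul ?_).sub hrem
  refine AnalyticAt.fun_comp ((hF (M - i) (Nat.sub_le _ _)).analytic _ fun n hn => ?_) (by fun_prop)
  exact hz (i + j + n) (by push_cast at hn ⊢; linear_combination hn)

theorem meromorphicAt_harmonicExpansion {K : ℕ} (hK : 2 ≤ K) {z : ℂ}
    (hzK : (M : ℝ) + 3 - K < z.re) : MeromorphicAt (harmonicExpansion F M K) z := by
  have hrem := analyticOnNhd_harmonicRemainder (m := M + 1) hK z
    (show ((M + 1 : ℕ) : ℝ) + 2 - K < z.re by push_cast; linarith)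
  refine (MeromorphicAt.fun_sum fun i _ => MeromorphicAt.fun_sum fun j _ =>
    ((differentiable_harmonicTermCoeff M i j).analyticAt z).meromorphicAt.mul ?_).sub
    hrem.meromorphicAt
  exact meromorphicAt_comp_add_const_iff_meromorphicAt.2
    ((hF (M - i) (Nat.sub_le _ _)).nf _).meromorphicAt

/-- At order `M + 1` only the term `i = 0`, `j = N`, which contains the pole of `F M` at `1`,
contributes at `1 - N`. -/
theorem harmonicExpansion_coeff {K N : ℕ} (hK : M + 3 + N ≤ K) :
    HasPoleCoeff (harmonicExpansion F M K) (1 - N) (M + 1)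
      (-((M + 1).factorial * (bernoulli N : ℂ))) := by
  have hK' : (M : ℝ) + 3 + N ≤ K := by exact_mod_cast hK
  have hrem := analyticOnNhd_harmonicRemainder (m := M + 1) (by lia : 2 ≤ K) (1 - N)
    (show ((M + 1 : ℕ) : ℝ) + 2 - K < (1 - N : ℂ).re by simp; linarith)
  set v : ℂ := -((M + 1).factorial * (bernoulli N : ℂ)) with hv
  have hterm : ∀ i ∈ Finset.range (M + 1), ∀ j ∈ Finset.range K, HasPoleCoeff
      (fun s => harmonicTermCoeff M i j s * F (M - i) (s + (i + j : ℕ))) (1 - N) (M + 1)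
      (if i = 0 then if j = N then v else 0 else 0) := by
    intro i hi j _
    have hiM : i ≤ M := Nat.lt_succ_iff.1 (Finset.mem_range.1 hi)
    have hG := hF (M - i) (Nat.sub_le _ _)
    have hcont := (differentiable_harmonicTermCoeff M i j).continuous.continuousAt
      (x := 1 - (N : ℂ))
    by_cases hij : i = 0 ∧ j = N
    · obtain ⟨rfl, rfl⟩ := hij
      have h := hG.coeff_zero
      rw [show (1 : ℂ) - (0 : ℕ) = 1 - j + (0 + j : ℕ) by simp] at h
      simp only [Nat.sub_zero] at h ⊢
      convert h.comp_add_const.const_mul_of_continuousAt hcont using 1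
      rw [harmonicTermCoeff_one_sub]
      simp [hv, Nat.factorial_succ]
      ring
    · have h0 : (if i = 0 then if j = N then v else 0 else 0) = 0 := by
        split_ifs <;> simp_all
      rw [h0]
      rcases le_or_gt (i + j) N with hd | hd
      · obtain ⟨c, hc⟩ := hG.coeff_shift hd
        refine (hc.const_mul_of_continuousAt hcont).of_lt ?_
        have h1 := poleShift_le_one (N - (i + j))
        have h2 : N - (i + j) ≠ 0 → _ := poleShift_le_zero
        lia
      · exact .of_continuousAt_of_pos (hcont.mul (hG.analyticAt_shift hd).continuousAt) (by lia)
  have hsum := (HasPoleCoeff.sum fun i hi => HasPoleCoeff.sum (hterm i hi)).sub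
    (HasPoleCoeff.of_continuousAt_of_pos hrem.continuousAt (by lia : (0 : ℤ) < M + 1))
  have hNK : N < K := by lia
  have hvalue : (∑ i ∈ Finset.range (M + 1), ∑ j ∈ Finset.range K,
      if i = 0 then if j = N then v else 0 else 0) - 0 = v := by
    simp [Finset.sum_ite_irrel, hNK]
  rw [hvalue] at hsum
  exact hsum

/-- At a negative even integer `1 - N` the terms of order `M` are those with `(i, j) = (0, 1)`,
`(0, N - 1)` and `(1, N - 1)`; for `M ≥ 1` the last two cancel. -/
theorem exists_harmonicExpansion_coeff_of_odd {K N : ℕ} (hK : M + 3 + N ≤ K) (hN : Odd N)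
    (hN1 : N ≠ 1) : ∃ c, c ≠ 0 ∧ HasPoleCoeff (harmonicExpansion F M K) (1 - N) M c := by
  have hK' : (M : ℝ) + 3 + N ≤ K := by exact_mod_cast hK
  have hrem := analyticOnNhd_harmonicRemainder (m := M + 1) (by lia : 2 ≤ K) (1 - N)
    (show ((M + 1 : ℕ) : ℝ) + 2 - K < (1 - N : ℂ).re by simp; linarith)
  obtain ⟨p, rfl⟩ : ∃ p, N = p + 1 := ⟨N - 1, (Nat.succ_pred_eq_of_pos hN.pos).symm⟩
  have hp : Even p := by
    have := Nat.Odd.sub_odd hN odd_one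
    simpa using this
  have hp0 : p ≠ 0 := by lia
  set B : ℂ := (bernoulli p : ℂ) with hB
  set c₀ : ℂ := if M = 0 then -1 / 2 else (M.factorial : ℂ) / 2 with hc₀
  set a : ℂ := (M + 1) * (p + 1) / 2 * (-(M.factorial * B / p)) with ha
  set b : ℂ := -((M + 1) * (p + 1) * B * c₀) with hb
  set c : ℂ := (M + 1).choose 2 * ((p + 1) * B) * (M - 1).factorial with hc
  have hterm : ∀ i ∈ Finset.range (M + 1), ∀ j ∈ Finset.range K, HasPoleCoeff
      (fun s => harmonicTermCoeff M i j s * F (M - i) (s + (i + j : ℕ))) (1 - (p + 1 : ℕ)) M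
      ((if i = 0 then (if j = 1 then a else 0) + (if j = p then b else 0) else 0) +
        (if i = 1 then if j = p then c else 0 else 0)) := by
    intro i hi j _
    have hiM : i ≤ M := Nat.lt_succ_iff.1 (Finset.mem_range.1 hi)
    have hG := hF (M - i) (Nat.sub_le _ _)
    have hcont := (differentiable_harmonicTermCoeff M i j).continuous.continuousAt
      (x := 1 - ((p + 1 : ℕ) : ℂ))
    have hval := harmonicTermCoeff_one_sub M i j (p + 1)
    have hp1 : p ≠ 1 := by rintro rfl; simp at hp
    by_cases h1 : i = 0 ∧ j = 1
    · obtain ⟨rfl, rfl⟩ := h1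
      have h := hG.coeff_even p hp0 hp
      rw [show (1 : ℂ) - p = 1 - (p + 1 : ℕ) + (0 + 1 : ℕ) by push_cast; ring] at h
      simp only [Nat.sub_zero] at h ⊢
      convert h.comp_add_const.const_mul_of_continuousAt hcont using 1
      rw [hval]
      simp [ha, hp1.symm]
      ring
    by_cases h2 : i = 0 ∧ j = p
    · obtain ⟨rfl, rfl⟩ := h2
      have h := hG.coeff_one
      rw [show (1 : ℂ) - (1 : ℕ) = 1 - (j + 1 : ℕ) + (0 + j : ℕ) by push_cast; ring] at h
      simp only [Nat.sub_zero] at h ⊢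
      convert h.comp_add_const.const_mul_of_continuousAt hcont using 1
      rw [hval, ← hc₀, ← hB, Nat.choose_succ_self_right]
      simp [hb, hp1]
      ring
    by_cases h3 : i = 1 ∧ j = p
    · obtain ⟨rfl, rfl⟩ := h3
      have h := hG.coeff_zero
      rw [show (1 : ℂ) - (0 : ℕ) = 1 - (j + 1 : ℕ) + (1 + j : ℕ) by push_cast; ring] at h
      convert h.comp_add_const.const_mul_of_continuousAt hcont using 1
      · lia
      · rw [hval, if_neg one_ne_zero, if_pos rfl, if_pos rfl, hc, hB, Nat.choose_succ_self_right]
        push_cast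
        ring
    have h0 : ((if i = 0 then (if j = 1 then a else 0) + (if j = p then b else 0) else 0) +
        (if i = 1 then if j = p then c else 0 else 0)) = 0 := by
      split_ifs <;> simp_all
    rw [h0]
    -- the pole of `F M` at `1` would contribute for `i = 0`, `j = p + 1`, but there `B_j = 0`
    by_cases h4 : Odd j ∧ j ≠ 1
    · have hz : ∀ s, harmonicTermCoeff M i j s * F (M - i) (s + (i + j : ℕ)) = 0 := fun s => by
        have := bernoulli_eq_zero_of_odd h4.1 (by have := h4.1.pos; lia)
        simp [harmonicTermCoeff, this]
      simp only [hz]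
      exact .of_continuousAt_of_eq_zero continuousAt_const rfl (by lia)
    rcases le_or_gt (i + j) (p + 1) with hd | hd
    · obtain ⟨e, he⟩ := hG.coeff_shift hd
      refine (he.const_mul_of_continuousAt hcont).of_lt ?_
      have hs1 := poleShift_le_one (p + 1 - (i + j))
      have hs2 : p + 1 - (i + j) ≠ 0 → _ := poleShift_le_zero
      rcases Nat.eq_zero_or_pos i with rfl | hi0
      · have hj1 : j ≠ 1 := by tauto
        have hjp : j ≠ p := by tauto
        have hje : Even j := by
          by_contra h
          exact h4 ⟨Nat.not_even_iff_odd.1 h, hj1⟩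
        have hjp1 : j ≠ p + 1 := by
          rintro rfl
          exact (Nat.not_even_iff_odd.2 hN) hje
        have hodd : Odd (p + 1 - (0 + j)) := by
          rw [zero_add]
          exact Nat.Odd.sub_even (by lia) hN hje
        rw [poleShift_of_odd hodd (by lia)]
        lia
      · lia
    · have han := hcont.mul (hG.analyticAt_shift hd).continuousAt
      rcases Nat.eq_zero_or_pos i with rfl | hi0
      -- here `M = 0` is possible, and it matters that `(1 - s choose j)` vanishes at `1 - (p + 1)`
      · refine .of_continuousAt_of_eq_zero han ?_ (by lia)
        rw [hval, Nat.choose_eq_zero_of_lt (by lia : p + 1 < j)]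
        simp
      · exact .of_continuousAt_of_pos han (by lia)
  have hsum := (HasPoleCoeff.sum fun i hi => HasPoleCoeff.sum (hterm i hi)).sub
    (HasPoleCoeff.of_continuousAt_of_eq_zero hrem.continuousAt
      (harmonicRemainder_one_sub_natCast (by lia) (by lia)) (by lia : (0 : ℤ) ≤ M))
  refine ⟨_, ?_, hsum⟩
  have h1K : 1 < K := by lia
  have hpK : p < K := by lia
  have hB0 : B ≠ 0 := bernoulli_ne_zero_of_even hp
  have hpC : (p : ℂ) ≠ 0 := Nat.cast_ne_zero.2 hp0
  have hp1C : (p : ℂ) + 1 ≠ 0 := by exact_mod_cast Nat.succ_ne_zero p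
  simp only [Finset.sum_add_distrib, Finset.sum_ite_irrel, Finset.sum_ite_eq', Finset.mem_range,
    Finset.sum_const_zero, h1K, hpK, if_true, Nat.succ_pos, sub_zero]
  -- for `M = 0` there is no term `i = 1`, and the value of `ζ` at `0` enters through `c₀`
  rcases Nat.eq_zero_or_pos M with rfl | hM
  · have hpm : (p : ℂ) - 1 ≠ 0 := by
      rw [sub_ne_zero]
      rintro h
      have : p = 1 := by exact_mod_cast h
      subst this
      simp at hp
    have h : a + b = (p + 1) * B * (p - 1) / (2 * p) := by
      simp [ha, hb, hc₀]
      field_simp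
      ring
    simp only [Nat.lt_irrefl, zero_add, if_false, add_zero, h]
    exact div_ne_zero (mul_ne_zero (mul_ne_zero hp1C hB0) hpm) (mul_ne_zero two_ne_zero hpC)
  · obtain ⟨L, rfl⟩ := Nat.exists_eq_succ_of_ne_zero hM.ne'
    have h : a + b + c = -((L + 1 + 1) * (L + 1).factorial * (p + 1) * B / (2 * p)) := by
      have hch : (((L + 1 + 1).choose 2 : ℕ) : ℂ) = (L + 1 + 1) * (L + 1) / 2 := by
        rw [Nat.cast_choose_two]
        push_cast
        ring
      simp only [ha, hb, hc, hc₀, Nat.succ_eq_add_one, hch, Nat.add_sub_cancel, Nat.factorial_succ]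
      simp
      field_simp
      ring
    have hL : (L : ℂ) + 1 + 1 ≠ 0 := by exact_mod_cast Nat.succ_ne_zero (L + 1)
    have hf : (((L + 1).factorial : ℕ) : ℂ) ≠ 0 := Nat.cast_ne_zero.2 (Nat.factorial_ne_zero _)
    rw [if_pos (by lia), h]
    exact neg_ne_zero.2 (div_ne_zero (mul_ne_zero (mul_ne_zero (mul_ne_zero hL hf) hp1C) hB0)
      (mul_ne_zero two_ne_zero hpC))

/-- The quotients of the expansions by `1 - s` glue to a continuation for the exponent `M + 1`. -/
theorem exists_isHarmonicContinuation_succ : ∃ G, IsHarmonicContinuation (M + 1) G := by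
  have hM0 : (0 : ℝ) ≤ M := M.cast_nonneg
  have hzK : ∀ (k : ℕ) (z : ℂ), -(k : ℝ) < z.re → (M : ℝ) + 3 - (M + 3 + k : ℕ) < z.re := by
    intro k z hz
    push_cast
    linarith
  obtain ⟨G, hnf, heq, hG⟩ := exists_meromorphicNFAt_glue (analyticOnNhd_harmonicZeta (M + 1))
    (fun k s => (1 - s)⁻¹ * harmonicExpansion F M (M + 3 + k) s)
    (fun k z hz => by
      have h := meromorphicAt_harmonicExpansion hF (by lia) (hzK k z hz)
      have h1 : MeromorphicAt (fun s : ℂ => (1 - s)⁻¹) z := by fun_prop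
      exact h1.mul h)
    (fun k s hs => by
      have h1 : 1 - s ≠ 0 := by
        rw [sub_ne_zero]
        rintro rfl
        norm_num at hs
      rw [harmonicExpansion_eq hF (by lia) hs, inv_mul_cancel_left₀ h1])
  have hcoeff : ∀ (N : ℕ) (e : ℤ) (c : ℂ), N ≠ 0 →
      HasPoleCoeff (harmonicExpansion F M (M + 3 + N)) (1 - N) e c →
      HasPoleCoeff G (1 - N) e (c / N) := by
    intro N e c hN h
    have hN' : (N : ℂ) ≠ 0 := Nat.cast_ne_zero.2 hN
    have hcont : ContinuousAt (fun s : ℂ => (1 - s)⁻¹) (1 - N) := by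
      refine ContinuousAt.inv₀ (by fun_prop) ?_
      simpa using hN'
    have h1 := (h.const_mul_of_continuousAt hcont).congr (hG N _ (by simp)).symm
    convert h1 using 1
    rw [sub_sub_cancel, div_eq_inv_mul]
  have heven : ∀ N : ℕ, N ≠ 0 → HasPoleCoeff G (1 - N) ((M + 1 : ℕ) : ℤ)
      (-((M + 1).factorial * (bernoulli N : ℂ) / N)) := by
    intro N hN
    have h := hcoeff N _ _ hN (harmonicExpansion_coeff hF (N := N) le_rfl)
    convert h using 1
    · exact Nat.cast_succ M
    · rw [neg_div]
  have hodd : ∀ N : ℕ, N ≠ 1 → Odd N →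
      ∃ c, c ≠ 0 ∧ HasPoleCoeff G (1 - N) (((M + 1 : ℕ) : ℤ) - 1) c := by
    intro N hN1 hN
    have hN0 : N ≠ 0 := by rintro rfl; simp at hN
    obtain ⟨c, hc, h⟩ := exists_harmonicExpansion_coeff_of_odd hF (K := M + 3 + N) le_rfl hN hN1
    refine ⟨c / N, div_ne_zero hc (Nat.cast_ne_zero.2 hN0), ?_⟩
    convert hcoeff N _ _ hN0 h using 1
    push_cast
    ring
  have hzero : HasPoleCoeff G (1 - (0 : ℕ)) ((M + 1 : ℕ) + 1) ((M + 1).factorial : ℂ) := by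
    have h := (harmonicExpansion_coeff hF (N := 0) (K := M + 3 + 0) le_rfl).neg
    refine HasPoleCoeff.congr ?_ (hG 0 _ (by simp)).symm
    simp only [bernoulli_zero, Rat.cast_one, mul_one, neg_neg] at h
    refine h.congr' ?_
    filter_upwards [HasPoleCoeff.eventually_ne _] with s hs
    have h1 : 1 - s ≠ 0 := fun h => hs (by simp; linear_combination -h)
    have h2 : s - 1 ≠ 0 := by simpa using hs
    have h3 : (s - (1 - (0 : ℕ))) = s - 1 := by simp
    rw [h3, Nat.cast_succ, zpow_add_one₀ h2 (M + 1 : ℤ)]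
    field_simp
    ring
  refine ⟨G, hnf, heq, fun z hz => ?_, fun N => ?_, hzero, ?_, fun N hN _ => heven N hN,
    fun _ => hodd⟩
  · obtain ⟨k, hk⟩ := exists_nat_gt (-z.re)
    have hk' : -(k : ℝ) < z.re := by linarith
    have h1 : 1 - z ≠ 0 := sub_ne_zero.2 fun h => hz 0 (by simp [h])
    have han : AnalyticAt ℂ (fun s => (1 - s)⁻¹ * harmonicExpansion F M (M + 3 + k) s) z :=
      (AnalyticAt.inv (by fun_prop) h1).mul
        (analyticAt_harmonicExpansion hF (by lia) (hzK k z hk') hz)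
    rw [← (hnf z).meromorphicOrderAt_nonneg_iff_analyticAt, meromorphicOrderAt_congr (hG k z hk')]
    exact han.meromorphicOrderAt_nonneg
  · rcases eq_or_ne N 0 with rfl | hN
    · exact ⟨_, hzero⟩
    by_cases h : N = 1 ∨ Even N
    · exact ⟨_, by simpa [poleShift, hN, h] using heven N hN⟩
    · push Not at h
      obtain ⟨c, -, hc⟩ := hodd N h.1 (Nat.not_even_iff_odd.1 h.2)
      exact ⟨c, by rwa [poleShift_of_odd (Nat.not_even_iff_odd.1 h.2) h.1]⟩
  · convert heven 1 one_ne_zero using 1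
    simp
    ring

end Step

theorem exists_isHarmonicContinuation (m : ℕ) : ∃ F, IsHarmonicContinuation m F := by
  induction m using Nat.strong_induction_on with
  | _ m ih =>
    rcases m with _ | M
    · exact exists_isHarmonicContinuation_zero
    · choose! F hF using ih
      exact exists_isHarmonicContinuation_succ (F := F) fun i hi => hF i (by lia)

theorem mainTheorem2 (m : ℕ) (hm : 1 ≤ m) :
    ∃ F : ℂ → ℂ,
      (∀ z : ℂ, MeromorphicAt F z) ∧
      (∀ s : ℂ, 1 < s.re → LSeriesSummable (harmonicPow m) s ∧ F s = harmonicZeta m s) ∧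
      (∀ z : ℂ, (∀ n : ℕ, z ≠ 1 - (n : ℂ)) → AnalyticAt ℂ F z) ∧
      HasPoleOfOrder F 1 ((m : ℤ) + 1) ∧
      HasPoleOfOrder F 0 (m : ℤ) ∧
      (∀ k : ℕ, HasPoleOfOrder F (-(2 * (k : ℂ) + 1)) (m : ℤ)) ∧
      (∀ k : ℕ, HasPoleOfOrder F (-(2 * (k : ℂ) + 2)) ((m : ℤ) - 1)) ∧
      (m = 1 → ∀ k : ℕ, AnalyticAt ℂ F (-(2 * (k : ℂ) + 2))) := by
  obtain ⟨F, hF⟩ := exists_isHarmonicContinuation m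
  have hm0 : m ≠ 0 := by lia
  have hfac : (m.factorial : ℂ) ≠ 0 := Nat.cast_ne_zero.2 m.factorial_ne_zero
  have hpole : ∀ {z : ℂ} {e : ℤ} {c : ℂ}, HasPoleCoeff F z e c → c ≠ 0 → HasPoleOfOrder F z e :=
    fun {z e c} h hc =>
      ⟨(hF.nf z).meromorphicAt, h.meromorphicOrderAt_eq hc (hF.nf z).meromorphicAt⟩
  have heven : ∀ k : ℕ, HasPoleOfOrder F (-(2 * (k : ℂ) + 2)) ((m : ℤ) - 1) := by
    intro k
    obtain ⟨c, hc, h⟩ := hF.coeff_odd hm0 (2 * k + 3) (by lia) (by use k + 1; ring)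
    have hz : (1 : ℂ) - (2 * k + 3 : ℕ) = -(2 * (k : ℂ) + 2) := by push_cast; ring
    exact hz ▸ hpole h hc
  refine ⟨F, fun z => (hF.nf z).meromorphicAt,
    fun s hs => ⟨lseriesSummable_harmonicPow m hs, hF.eq s hs⟩, hF.analytic, ?_, ?_, fun k => ?_,
    heven, ?_⟩
  · simpa using hpole hF.coeff_zero hfac
  · have h := hF.coeff_one
    rw [if_neg hm0] at h
    simpa using hpole h (div_ne_zero hfac two_ne_zero)
  · have hN0 : 2 * k + 2 ≠ 0 := by lia
    have hev : Even (2 * k + 2) := by use k + 1; ring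
    have hz : (1 : ℂ) - (2 * k + 2 : ℕ) = -(2 * (k : ℂ) + 1) := by push_cast; ring
    refine hz ▸ hpole (hF.coeff_even _ hN0 hev) (neg_ne_zero.2 (div_ne_zero (mul_ne_zero hfac
      (bernoulli_ne_zero_of_even hev)) (Nat.cast_ne_zero.2 hN0)))
  · rintro rfl k
    rw [← (hF.nf _).meromorphicOrderAt_nonneg_iff_analyticAt, (heven k).2]
    simp
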